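/- Let $S$ be a countable state space, $\Xi$ a complete separable metric space, $h:S\times\Xi\to S$ measurable, and $\xi=(\xi_t)_{t\in\mathbb Z}$ a sequence of $\Xi$-valued random variables on a probability space. The follow map is $f_+(t,x)=(t+1,h(x,\xi_t))$ on $\mathbb Z\times S$, and the Doeblin graph $G$ is the random graph with vertex set $V(G)=\mathbb Z\times S$ and an edge from each $(t,x)$ to $f_+(t,x)$; its components are those of the underlying undirected graph, and $G$ is called an eternal family tree (EFT) if it is a.s. connected. A path in $G$ is a family of vertices $(t,X_t)_{t\in I}$, with $I$ an interval of $\mathbb Z$, such that $(t+1,X_{t+1})=f_+(t,X_t)$ whenever $t,t+1\in I$; the path of a vertex $(t,x)$ is $(f_+^n(t,x))_{n\ge 0}$. Assume that $G$ has fully independent transitions: $\xi$ is i.i.d., and for each $t\in\mathbb Z$ the family $(f_+(t,x))_{x\in S}$ is independent. Let $P=(p_{x,y})_{x,y\in S}$, $p_{x,y}=\mathbb P(h(x,\xi_0)=y)$. A state $x$ is recurrent (positive recurrent) if the first return time to $x$ of the chain started at $x$ is a.s. finite (has finite expectation), and transient if it is not recurrent. (1) Assume that all recurrent communication classes of $P$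 are positive recurrent ($P$ is strongly recurrent), and that any Markov chain with transition matrix $P$ a.s. eventually enters a recurrent state ($P$ is recurrent-attracting). Let $S=T\cup\bigcup_{i\in\mathcal I}R^i$ be the decomposition of $S$ into the set $T$ of transient states and the distinct recurrent communication classes $R^i$, let $d(i)$ be the period of $R^i$, and let $R^i=C^i_0\cup\dots\cup C^i_{d(i)-1}$ be a cyclic decomposition (a partition such that $x\in C^i_j$, $y\in R^i$, $p_{x,y}>0$ imply $y\in C^i_{j+1}$, with lower indices modulo $d(i)$). Then the sets $C^i_j$ are pairwise distinct and, almost surely, the components of $G$ are in bijection with them and can be listed without repetition as $\mathcal C^i_j$, $i\in\mathcal I$, $0\le j<d(i)$, in such a way that: (a) for $x\in C^i_j$ and $t\in\mathbb Z$, $(t,x)\in V(\mathcal C^i_{j'})$ if and only if $j-t\equiv j'\pmod{d(i)}$; (b) for $x\in T$ and $t\in\mathbb Z$, the path of $(t,x)$ contains a vertex with recurrent state, and for any such vertex $(t',y)$ and all $i,j$, $(t,x)\in V(\mathcal C^i_j)$ if and only if $(t',y)\in V(\mathcal C^i_j)$; (c) $V(\mathcal C^i_j)$ is the set of all vertices of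 all paths in $G$ that pass through an element of $C^i_j$ at some time $t\equiv 0\pmod{d(i)}$. (2) If $P$ is irreducible (in particular $S\neq\emptyset$) and positive recurrent with period $d$, then a.s. $G$ has exactly $d$ components. In particular, if moreover $P$ is aperiodic ($d=1$), then $G$ is an EFT. -/

import Mathlib

open MeasureTheory ProbabilityTheory
open scoped ENNReal

noncomputable section

namespace Doeblin

universe u v w

/-! ### Stochastic matrices on a countable state space -/

section Chain

variable {S : Type u}

open Classical in
/-- The entries of the powers `P ^ n` of a matrix `P` with entries in `[0, ∞]`. -/
def stepProb (P : S → S → ℝ≥0∞) : ℕ → S → S → ℝ≥0∞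
  | 0, x, y => if x = y then 1 else 0
  | n + 1, x, y => ∑' z, P x z * stepProb P n z y

/-- The state `y` can be reached from `x` in `n ≥ 0` steps with positive probability. -/
def Accessible (P : S → S → ℝ≥0∞) (x y : S) : Prop :=
  ∃ n : ℕ, 0 < stepProb P n x y

/-- The communication class of a state. -/
def commClass (P : S → S → ℝ≥0∞) (x : S) : Set S :=
  {y | Accessible P x y ∧ Accessible P y x}

/-- Irreducibility (the state space is nonempty and any two states communicate). -/
def IsIrreducible (P : S → S → ℝ≥0∞) : Prop :=
  Nonempty S ∧ ∀ x y, Accessible P x y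

/-- The period of a class `R` of states: the greatest common divisor of all `n ≥ 1` such that a
return to some `x ∈ R` in `n` steps has positive probability. -/
def period (P : S → S → ℝ≥0∞) (R : Set S) : ℕ :=
  sSup {d : ℕ | ∀ x ∈ R, ∀ n : ℕ, 1 ≤ n → 0 < stepProb P n x x → d ∣ n}

/-- `C 0, …, C (d - 1)` (indices modulo `d`) is a cyclic decomposition of the class `R`. -/
structure IsCyclicDecomposition (P : S → S → ℝ≥0∞) (R : Set S) (d : ℕ)
    (C : ZMod d → Set S) : Prop where
  iUnion_eq : ⋃ j, C j = R
  disjoint : ∀ j j', j ≠ j' → Disjoint (C j) (C j')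
  step : ∀ j, ∀ x ∈ C j, ∀ y ∈ R, 0 < P x y → y ∈ C (j + 1)

/-- `X` is a Markov chain with transition matrix `P` (and arbitrary initial law) on the
probability space `(Ω, ν)`. -/
structure IsMarkovChain {Ω : Type w} [MeasurableSpace Ω] [MeasurableSpace S]
    (P : S → S → ℝ≥0∞) (ν : Measure Ω) (X : ℕ → Ω → S) : Prop where
  measurable : ∀ n, Measurable (X n)
  markov : ∀ (n : ℕ) (x : ℕ → S),
    ν {ω | ∀ k ≤ n + 1, X k ω = x k} = ν {ω | ∀ k ≤ n, X k ω = x k} * P (x n) (x (n + 1))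

end Chain

/-! ### The graph of one realization of the driving sequence -/

section Graph

variable {S : Type u} {Ξ : Type v}

/-- The follow map `f₊ (t, x) = (t + 1, h (x, ξ_t))`. -/
def followMap (h : S × Ξ → S) (ξ : ℤ → Ξ) (p : ℤ × S) : ℤ × S :=
  (p.1 + 1, h (p.2, ξ p.1))

/-- The Doeblin graph, with vertex set `ℤ × S` and an edge joining each vertex to its image under
the follow map (orientations are forgotten; they are recovered from the time coordinates). -/
def graph (h : S × Ξ → S) (ξ : ℤ → Ξ) : SimpleGraph (ℤ × S) :=
  SimpleGraph.fromRel fun p q => q = followMap h ξ p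

/-- `(t, X t)`, `t ∈ I`, is a (directed) path in the Doeblin graph over the interval `I` of `ℤ`. -/
structure IsStatePath (h : S × Ξ → S) (ξ : ℤ → Ξ) (I : Set ℤ) (X : ℤ → S) : Prop where
  interval : I.OrdConnected
  edge : ∀ t ∈ I, t + 1 ∈ I → followMap h ξ (t, X t) = (t + 1, X (t + 1))

/-- The time `inf {s > t : F_s = y} - t ∈ ℕ ∪ {∞}` until the path `F` started at time `t` in
state `x` (re)turns to `y`. -/
def returnTime (h : S × Ξ → S) (ξ : ℤ → Ξ) (t : ℤ) (x y : S) : ℕ∞ :=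
  ⨅ (n : ℕ) (_ : 1 ≤ n ∧ ((followMap h ξ)^[n] (t, x)).2 = y), (n : ℕ∞)

end Graph

/-! ### The random graph -/

section Random

variable {S : Type u} {Ξ : Type v} {Ω : Type w} [MeasurableSpace S] [MeasurableSpace Ξ]
  [MeasurableSpace Ω]

/-- Fully independent transitions: the driving sequence is i.i.d., and at each fixed time the
moves out of the different states are independent. -/
structure FullyIndependentTransitions (h : S × Ξ → S) (ξ : ℤ → Ω → Ξ) (μ : Measure Ω) :
    Prop where
  indep : iIndepFun ξ μ
  identDistrib : ∀ t, IdentDistrib (ξ t) (ξ 0) μ μ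
  vertical : ∀ t : ℤ, iIndepFun (fun (x : S) (ω : Ω) => followMap h (fun s => ξ s ω) (t, x)) μ

/-- The transition matrix `p_{x,y} = ℙ (h (x, ξ_0) = y)`. -/
def transition (h : S × Ξ → S) (ξ : ℤ → Ω → Ξ) (μ : Measure Ω) (x y : S) : ℝ≥0∞ :=
  μ {ω | h (x, ξ 0 ω) = y}

/-- Recurrence of a state: the return time is almost surely finite. -/
def IsRecurrent (h : S × Ξ → S) (ξ : ℤ → Ω → Ξ) (μ : Measure Ω) (x : S) : Prop :=
  ∀ᵐ ω ∂μ, returnTime h (fun s => ξ s ω) 0 x x < ⊤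

/-- Positive recurrence of a state: the return time has finite expectation. -/
def IsPositiveRecurrent (h : S × Ξ → S) (ξ : ℤ → Ω → Ξ) (μ : Measure Ω) (x : S) : Prop :=
  ∫⁻ ω, (returnTime h (fun s => ξ s ω) 0 x x : ℝ≥0∞) ∂μ < ∞

/-- The set of all recurrent communication classes. -/
def recurrentClasses (h : S × Ξ → S) (ξ : ℤ → Ω → Ξ) (μ : Measure Ω) : Set (Set S) :=
  {R | ∃ x, IsRecurrent h ξ μ x ∧ R = commClass (transition h ξ μ) x}

/-- Strong recurrence: all recurrent classes are positive recurrent. -/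
def IsStronglyRecurrent (h : S × Ξ → S) (ξ : ℤ → Ω → Ξ) (μ : Measure Ω) : Prop :=
  ∀ R ∈ recurrentClasses h ξ μ, ∀ x ∈ R, IsPositiveRecurrent h ξ μ x

/-- Recurrent-attracting: any Markov chain with the given transition matrix almost surely
eventually enters a recurrent state. -/
def IsRecurrentAttracting (h : S × Ξ → S) (ξ : ℤ → Ω → Ξ) (μ : Measure Ω) : Prop :=
  ∀ (Ω' : Type w) [MeasurableSpace Ω'] (ν : Measure Ω') [IsProbabilityMeasure ν]
    (X : ℕ → Ω' → S), IsMarkovChain (transition h ξ μ) ν X →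
      ∀ᵐ ω ∂ν, ∃ n, IsRecurrent h ξ μ (X n ω)

/-- The Doeblin graph is an eternal family tree (EFT): it is almost surely connected. -/
def IsEFT (h : S × Ξ → S) (ξ : ℤ → Ω → Ξ) (μ : Measure Ω) : Prop :=
  ∀ᵐ ω ∂μ, (graph h fun s => ξ s ω).Connected

end Random

end Doeblin

end

noncomputable section

namespace Doeblin

universe u v w

set_option linter.unusedSectionVars false

/-! ### Nonnegative kernels on a discrete space -/

section Kernels

variable {α : Type u}

lemma tsum_iInf_of_antitone {f : ℕ → α → ℝ≥0∞} (hf : Antitone f)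
    (h0 : ∑' a, f 0 a ≠ ∞) : ∑' a, ⨅ n, f n a = ⨅ n, ∑' a, f n a := by
  let _ : MeasurableSpace α := ⊤
  simpa [lintegral_count] using
    lintegral_iInf (μ := Measure.count) (f := f) (fun n => measurable_from_top) hf
      (by simpa [lintegral_count] using h0)

/-- If `f ≤ g` have equal finite sums, they are equal. -/
lemma eq_of_le_of_tsum_eq {f g : α → ℝ≥0∞} (hfg : ∀ a, f a ≤ g a)
    (hsum : ∑' a, g a ≤ ∑' a, f a) (hfin : ∑' a, f a ≠ ∞) (a : α) : f a = g a := by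
  have h1 : ∑' b, (g b - f b) = 0 := by
    have h2 : ∑' b, (g b - f b) + ∑' b, f b = ∑' b, g b := by
      rw [← ENNReal.tsum_add]
      exact tsum_congr fun b => tsub_add_cancel_of_le (hfg b)
    have h3 : ∑' b, (g b - f b) + ∑' b, f b ≤ 0 + ∑' b, f b := by rw [h2, zero_add]; exact hsum
    exact le_antisymm ((ENNReal.add_le_add_iff_right hfin).1 h3) zero_le
  exact le_antisymm (hfg a) (tsub_eq_zero_iff_le.1 (ENNReal.tsum_eq_zero.1 h1 a))

/-- A bounded subharmonic function is harmonic on the support of a finite invariant measure, so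
that its zero set propagates along the transitions. -/
lemma subharmonic_zero_propagates {Q : α → α → ℝ≥0∞} {m f : α → ℝ≥0∞}
    (hm : ∀ b, ∑' a, m a * Q a b = m b) (hfin : ∑' a, m a ≠ ∞) (hf1 : ∀ a, f a ≤ 1)
    (hf : ∀ a, f a ≤ ∑' b, Q a b * f b) {a b : α} (ha : m a ≠ 0) (hfa : f a = 0)
    (hab : Q a b ≠ 0) : m b ≠ 0 ∧ f b = 0 := by
  have hmb : m b ≠ 0 := by
    rw [← hm b]
    exact fun h0 => mul_ne_zero ha hab (ENNReal.tsum_eq_zero.1 h0 a)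
  refine ⟨hmb, ?_⟩
  have hsum : ∑' a, m a * ∑' b, Q a b * f b = ∑' a, m a * f a := by
    simp_rw [← ENNReal.tsum_mul_left]
    rw [ENNReal.tsum_comm]
    refine tsum_congr fun b => ?_
    simp_rw [← mul_assoc]
    rw [ENNReal.tsum_mul_right, hm]
  have hfin' : ∑' a, m a * f a ≠ ∞ :=
    ne_top_of_le_ne_top hfin (ENNReal.tsum_le_tsum fun a => mul_le_of_le_one_right' (hf1 a))
  have h1 := eq_of_le_of_tsum_eq (fun a => mul_le_mul_right (hf a) (m a)) hsum.le hfin' a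
  rw [hfa, mul_zero, eq_comm, mul_eq_zero, or_iff_right ha, ENNReal.tsum_eq_zero] at h1
  exact (mul_eq_zero.1 (h1 b)).resolve_left hab

open Classical in
/-- The probability that the chain started at `a` avoids `D` at the times `0, …, n`. -/
def avoidProb (Q : α → α → ℝ≥0∞) (D : Set α) : ℕ → α → ℝ≥0∞
  | 0, a => if a ∈ D then 0 else 1
  | n + 1, a => if a ∈ D then 0 else ∑' b, Q a b * avoidProb Q D n b

lemma avoidProb_of_mem (Q : α → α → ℝ≥0∞) {D : Set α} (n : ℕ) {a : α} (ha : a ∈ D) :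
    avoidProb Q D n a = 0 := by
  cases n <;> simp [avoidProb, ha]

lemma avoidProb_succ_of_notMem (Q : α → α → ℝ≥0∞) {D : Set α} (n : ℕ) {a : α} (ha : a ∉ D) :
    avoidProb Q D (n + 1) a = ∑' b, Q a b * avoidProb Q D n b := by
  simp [avoidProb, ha]

lemma avoidProb_zero_le_one (Q : α → α → ℝ≥0∞) (D : Set α) (a : α) :
    avoidProb Q D 0 a ≤ 1 := by
  unfold avoidProb; split_ifs <;> simp

lemma avoidProb_antitone {Q : α → α → ℝ≥0∞} (hQ : ∀ a, ∑' b, Q a b = 1) (D : Set α) :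
    Antitone (avoidProb Q D) := by
  refine antitone_nat_of_succ_le fun n => ?_
  induction n with
  | zero =>
    intro a
    by_cases ha : a ∈ D
    · simp [avoidProb_of_mem Q _ ha]
    · rw [avoidProb_succ_of_notMem Q _ ha]
      rw [show avoidProb Q D 0 a = ∑' b, Q a b by simp [avoidProb, ha, hQ]]
      exact ENNReal.tsum_le_tsum fun b => mul_le_of_le_one_right' (avoidProb_zero_le_one Q D b)
  | succ n ih =>
    intro a
    by_cases ha : a ∈ D
    · simp [avoidProb_of_mem Q _ ha]
    · rw [avoidProb_succ_of_notMem Q _ ha, avoidProb_succ_of_notMem Q _ ha]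
      exact ENNReal.tsum_le_tsum fun b => mul_le_mul_right (ih b) _

lemma iInf_avoidProb_le_one (Q : α → α → ℝ≥0∞) (D : Set α) (a : α) :
    ⨅ n, avoidProb Q D n a ≤ 1 :=
  iInf_le_of_le 0 (avoidProb_zero_le_one Q D a)

lemma iInf_avoidProb_subharmonic {Q : α → α → ℝ≥0∞} (hQ : ∀ a, ∑' b, Q a b = 1)
    (D : Set α) (a : α) :
    ⨅ n, avoidProb Q D n a ≤ ∑' b, Q a b * ⨅ n, avoidProb Q D n b := by
  have hanti := avoidProb_antitone hQ D
  have hfin : ∑' b, Q a b * avoidProb Q D 0 b ≠ ∞ := by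
    refine ne_top_of_le_ne_top ENNReal.one_ne_top ?_
    rw [← hQ a]
    exact ENNReal.tsum_le_tsum fun b => mul_le_of_le_one_right' (avoidProb_zero_le_one Q D b)
  have hQfin : ∀ b, Q a b ≠ ∞ := fun b =>
    ne_top_of_le_ne_top ENNReal.one_ne_top ((ENNReal.le_tsum b).trans (hQ a).le)
  have h1 : ∑' b, Q a b * ⨅ n, avoidProb Q D n b
      = ⨅ n, ∑' b, Q a b * avoidProb Q D n b := by
    rw [← tsum_iInf_of_antitone (f := fun n b => Q a b * avoidProb Q D n b)
      (fun m n hmn b => mul_le_mul_right (hanti hmn b) _) hfin]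
    exact tsum_congr fun b => ENNReal.mul_iInf fun h => absurd h (hQfin b)
  rw [h1]
  refine le_iInf fun n => ?_
  by_cases ha : a ∈ D
  · exact iInf_le_of_le 0 (by simp [avoidProb_of_mem Q _ ha])
  · exact iInf_le_of_le (n + 1) (avoidProb_succ_of_notMem Q n ha).le

/-- The expected occupation measure of an excursion away from `x` is invariant. -/
lemma tsum_taboo_invariant {P : α → α → ℝ≥0∞} (hP : ∀ a, ∑' b, P a b = 1) {x : α}
    {a : ℕ → α → ℝ≥0∞} (h0 : ∀ y, y ≠ x → a 0 y = 0) (h0x : a 0 x = 1)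
    (hsx : ∀ n, a (n + 1) x = 0)
    (hs : ∀ n y, y ≠ x → a (n + 1) y = ∑' z, a n z * P z y)
    (hfin : ∑' n, ∑' y, a n y ≠ ∞) :
    ∃ m : α → ℝ≥0∞, (∀ y, ∑' z, m z * P z y = m y) ∧ ∑' y, m y ≠ ∞ ∧ m x = 1 := by
  have hfin' : ∑' y, ∑' n, a n y ≠ ∞ := by rwa [ENNReal.tsum_comm]
  have hx : ∑' n, a n x = 1 := by
    rw [tsum_eq_single 0 fun n hn => ?_, h0x]
    obtain ⟨k, rfl⟩ := Nat.exists_eq_succ_of_ne_zero hn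
    exact hsx k
  have hcomm : ∀ y, ∑' z, (∑' n, a n z) * P z y = ∑' n, ∑' z, a n z * P z y := fun y => by
    simp_rw [← ENNReal.tsum_mul_right]
    exact ENNReal.tsum_comm
  have hne : ∀ y, y ≠ x → ∑' z, (∑' n, a n z) * P z y = ∑' n, a n y := by
    intro y hy
    rw [hcomm, tsum_eq_zero_add' (f := fun n => a n y) ENNReal.summable, h0 y hy, zero_add]
    exact tsum_congr fun n => (hs n y hy).symm
  have htot : ∑' y, ∑' z, (∑' n, a n z) * P z y = ∑' z, ∑' n, a n z := by
    rw [ENNReal.tsum_comm]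
    simp_rw [ENNReal.tsum_mul_left, hP, mul_one]
  refine ⟨fun y => ∑' n, a n y, fun y => ?_, hfin', hx⟩
  by_cases hy : y = x
  · subst hy
    classical
    rw [ENNReal.tsum_eq_add_tsum_ite (f := fun y => ∑' z, (∑' n, a n z) * P z y) y,
      ENNReal.tsum_eq_add_tsum_ite (f := fun z => ∑' n, a n z) y] at htot
    have hrest : ∑' z, (if z = y then 0 else ∑' w, (∑' n, a n w) * P w z)
        = ∑' z, (if z = y then 0 else ∑' n, a n z) := by
      refine tsum_congr fun z => ?_
      split_ifs with hz
      · rfl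
      · exact hne z hz
    rw [hrest] at htot
    refine (ENNReal.add_left_inj ?_).1 htot
    refine ne_top_of_le_ne_top hfin' (ENNReal.tsum_le_tsum fun z => ?_)
    split_ifs <;> simp
  · exact hne y hy

lemma tsum_prod_kernel {P : α → α → ℝ≥0∞} (hP : ∀ a, ∑' b, P a b = 1) (a : α × α) :
    ∑' b : α × α, P a.1 b.1 * P a.2 b.2 = 1 := by
  rw [ENNReal.tsum_prod (f := fun b c => P a.1 b * P a.2 c)]
  simp_rw [ENNReal.tsum_mul_left, hP, mul_one, hP]

lemma prod_invariant {P : α → α → ℝ≥0∞} {m : α → ℝ≥0∞}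
    (hm : ∀ b, ∑' a, m a * P a b = m b) (b : α × α) :
    ∑' a : α × α, m a.1 * m a.2 * (P a.1 b.1 * P a.2 b.2) = m b.1 * m b.2 := by
  rw [ENNReal.tsum_prod (f := fun a c => m a * m c * (P a b.1 * P c b.2))]
  simp_rw [mul_mul_mul_comm, ENNReal.tsum_mul_left, hm, ENNReal.tsum_mul_right, hm]

lemma tsum_prod_mass_ne_top {m : α → ℝ≥0∞} (hm : ∑' a, m a ≠ ∞) :
    ∑' a : α × α, m a.1 * m a.2 ≠ ∞ := by
  rw [ENNReal.tsum_prod (f := fun a c => m a * m c)]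
  simp_rw [ENNReal.tsum_mul_left, ENNReal.tsum_mul_right]
  exact ENNReal.mul_ne_top hm hm

end Kernels

/-! ### Accessibility, closed classes and periods -/

section Accessibility

variable {S : Type u} {P : S → S → ℝ≥0∞}

lemma stepProb_succ_pos {n : ℕ} {x y : S} :
    0 < stepProb P (n + 1) x y ↔ ∃ z, 0 < P x z ∧ 0 < stepProb P n z y := by
  simp only [stepProb, pos_iff_ne_zero, ne_eq, ENNReal.tsum_eq_zero, mul_eq_zero, not_forall,
    not_or]

lemma stepProb_zero_pos {x y : S} : 0 < stepProb P 0 x y ↔ x = y := by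
  simp only [stepProb]; split_ifs <;> simp_all

lemma stepProb_one_pos {x y : S} : 0 < stepProb P 1 x y ↔ 0 < P x y := by
  simp [stepProb_succ_pos, stepProb_zero_pos]

lemma stepProb_add_pos {m n : ℕ} {x y z : S} (hxy : 0 < stepProb P m x y)
    (hyz : 0 < stepProb P n y z) : 0 < stepProb P (m + n) x z := by
  induction m generalizing x with
  | zero => rw [stepProb_zero_pos] at hxy; subst hxy; simpa using hyz
  | succ m ih =>
    obtain ⟨w, hw, hwy⟩ := stepProb_succ_pos.1 hxy
    rw [Nat.add_right_comm]
    exact stepProb_succ_pos.2 ⟨w, hw, ih hwy⟩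

lemma Accessible.refl (x : S) : Accessible P x x := ⟨0, stepProb_zero_pos.2 rfl⟩

lemma Accessible.trans {x y z : S} (hxy : Accessible P x y) (hyz : Accessible P y z) :
    Accessible P x z :=
  let ⟨m, hm⟩ := hxy
  let ⟨n, hn⟩ := hyz
  ⟨m + n, stepProb_add_pos hm hn⟩

lemma Accessible.of_pos {x y : S} (hxy : 0 < P x y) : Accessible P x y :=
  ⟨1, stepProb_one_pos.2 hxy⟩

lemma mem_commClass_self (x : S) : x ∈ commClass P x := ⟨.refl x, .refl x⟩

lemma commClass_eq_of_mem {x y : S} (hy : y ∈ commClass P x) :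
    commClass P y = commClass P x :=
  Set.ext fun _ => ⟨fun hz => ⟨hy.1.trans hz.1, hz.2.trans hy.2⟩,
    fun hz => ⟨hy.2.trans hz.1, hz.2.trans hy.1⟩⟩

/-- A finite invariant measure charging `x` forces every state accessible from `x` to lead back
to `x`. -/
lemma accessible_symm_of_invariant (hP : ∀ a, ∑' b, P a b = 1) {m : S → ℝ≥0∞}
    (hm : ∀ b, ∑' a, m a * P a b = m b) (hfin : ∑' a, m a ≠ ∞) {x y : S} (hx : m x ≠ 0)
    (hxy : Accessible P x y) : Accessible P y x := by
  classical
  let f : S → ℝ≥0∞ := fun z => if Accessible P z x then 0 else 1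
  have hf1 : ∀ a, f a ≤ 1 := fun a => by simp only [f]; split_ifs <;> simp
  have hf : ∀ a, f a ≤ ∑' b, P a b * f b := by
    intro a
    by_cases ha : Accessible P a x
    · simp [f, ha]
    · calc f a ≤ ∑' b, P a b := (hf1 a).trans (hP a).ge
        _ ≤ ∑' b, P a b * f b := by
          refine ENNReal.tsum_le_tsum fun b => ?_
          by_cases hab : P a b = 0
          · simp [hab]
          · have hb : ¬ Accessible P b x := fun hb =>
              ha ((Accessible.of_pos (pos_iff_ne_zero.2 hab)).trans hb)
            simp [f, hb]
  have key : ∀ (n : ℕ) (z : S), m z ≠ 0 → f z = 0 → 0 < stepProb P n z y → f y = 0 := by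
    intro n
    induction n with
    | zero => intro z _ hz hzy; rwa [← stepProb_zero_pos.1 hzy]
    | succ n ih =>
      intro z hmz hz hzy
      obtain ⟨w, hzw, hwy⟩ := stepProb_succ_pos.1 hzy
      obtain ⟨h1, h2⟩ := subharmonic_zero_propagates hm hfin hf1 hf hmz hz hzw.ne'
      exact ih w h1 h2 hwy
  obtain ⟨n, hn⟩ := hxy
  have := key n x hx (by simp [f, Accessible.refl]) hn
  by_contra hyx
  simp [f, hyx] at this

/-- Coalescence of independent copies: if `x` is charged by a finite invariant measure, and `y`,
`z` can be reached from `x` in the same number of steps, then two independent chains started at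
`y` and `z` almost surely meet. -/
lemma iInf_avoidProb_diagonal_eq_zero (hP : ∀ a, ∑' b, P a b = 1) {m : S → ℝ≥0∞}
    (hm : ∀ b, ∑' a, m a * P a b = m b) (hfin : ∑' a, m a ≠ ∞) {x y z : S} (hx : m x ≠ 0)
    {n : ℕ} (hy : 0 < stepProb P n x y) (hz : 0 < stepProb P n x z) :
    ⨅ k, avoidProb (fun a b : S × S => P a.1 b.1 * P a.2 b.2) (Set.diagonal S) k (y, z) = 0 := by
  set Q : S × S → S × S → ℝ≥0∞ := fun a b => P a.1 b.1 * P a.2 b.2 with hQ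
  have key : ∀ (n : ℕ) (a b : S), m a * m b ≠ 0 →
      ⨅ k, avoidProb Q (Set.diagonal S) k (a, b) = 0 →
      0 < stepProb P n a y → 0 < stepProb P n b z →
      ⨅ k, avoidProb Q (Set.diagonal S) k (y, z) = 0 := by
    intro n
    induction n with
    | zero =>
      intro a b _ h0 ha hb
      rwa [← stepProb_zero_pos.1 ha, ← stepProb_zero_pos.1 hb]
    | succ n ih =>
      intro a b hab h0 ha hb
      obtain ⟨a', haa, ha'⟩ := stepProb_succ_pos.1 ha
      obtain ⟨b', hbb, hb'⟩ := stepProb_succ_pos.1 hb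
      obtain ⟨h1, h2⟩ := subharmonic_zero_propagates (Q := Q)
        (m := fun p : S × S => m p.1 * m p.2)
        (f := fun p => ⨅ k, avoidProb Q (Set.diagonal S) k p) (a := (a, b)) (b := (a', b'))
        (prod_invariant hm) (tsum_prod_mass_ne_top hfin) (iInf_avoidProb_le_one Q _)
        (iInf_avoidProb_subharmonic (tsum_prod_kernel hP) _) hab h0
        (mul_ne_zero haa.ne' hbb.ne')
      exact ih a' b' h1 h2 ha' hb'
  refine key n x x (mul_ne_zero hx hx) (le_antisymm (iInf_le_of_le 0 ?_) zero_le) hy hz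
  exact (avoidProb_of_mem Q 0 (Set.mem_diagonal x)).le

/-- `R` is a closed communicating class. -/
structure IsClosedClass (P : S → S → ℝ≥0∞) (R : Set S) : Prop where
  nonempty : R.Nonempty
  accessible : ∀ x ∈ R, ∀ y ∈ R, Accessible P x y
  closed : ∀ x ∈ R, ∀ y, 0 < P x y → y ∈ R

lemma IsClosedClass.stepProb_mem {R : Set S} (hR : IsClosedClass P R) {n : ℕ} {x y : S}
    (hx : x ∈ R) (hxy : 0 < stepProb P n x y) : y ∈ R := by
  induction n generalizing x with
  | zero => rwa [← stepProb_zero_pos.1 hxy]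
  | succ n ih =>
    obtain ⟨z, hxz, hzy⟩ := stepProb_succ_pos.1 hxy
    exact ih (hR.closed x hx z hxz) hzy

lemma exists_pos_of_tsum_eq_one (hP : ∀ a, ∑' b, P a b = 1) (x : S) : ∃ y, 0 < P x y := by
  by_contra! h
  have := hP x
  simp [fun y => le_antisymm (h y) zero_le] at this

lemma IsClosedClass.period_spec (hP : ∀ a, ∑' b, P a b = 1) {R : Set S}
    (hR : IsClosedClass P R) :
    0 < period P R ∧ (∀ x ∈ R, ∀ n : ℕ, 0 < stepProb P n x x → period P R ∣ n) ∧
    ∀ d : ℕ, (∀ x ∈ R, ∀ n : ℕ, 1 ≤ n → 0 < stepProb P n x x → d ∣ n) → d ≤ period P R := by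
  obtain ⟨x, hx⟩ := hR.nonempty
  obtain ⟨y, hxy⟩ := exists_pos_of_tsum_eq_one hP x
  obtain ⟨n, hn⟩ := hR.accessible y (hR.closed x hx y hxy) x hx
  have hbdd : BddAbove {d : ℕ | ∀ x ∈ R, ∀ n : ℕ, 1 ≤ n → 0 < stepProb P n x x → d ∣ n} :=
    ⟨n + 1, fun d hd => Nat.le_of_dvd n.succ_pos
      (hd x hx (n + 1) (by omega) (stepProb_succ_pos.2 ⟨y, hxy, hn⟩))⟩
  have hle : ∀ d : ℕ, (∀ x ∈ R, ∀ n : ℕ, 1 ≤ n → 0 < stepProb P n x x → d ∣ n) →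
      d ≤ period P R := fun d hd => le_csSup hbdd hd
  refine ⟨hle 1 fun _ _ _ _ _ => one_dvd _, fun x hx n hn => ?_, hle⟩
  have hone : (1 : ℕ) ∈ {d : ℕ | ∀ x ∈ R, ∀ n : ℕ, 1 ≤ n → 0 < stepProb P n x x → d ∣ n} :=
    fun _ _ _ _ _ => one_dvd _
  have hmem := Nat.sSup_mem ⟨1, hone⟩ hbdd
  rcases Nat.eq_zero_or_pos n with rfl | hpos
  · exact dvd_zero _
  · exact hmem x hx n hpos hn

/-- Returns happen with positive probability at all large multiples of the period. -/
lemma IsClosedClass.exists_return (hP : ∀ a, ∑' b, P a b = 1) {R : Set S}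
    (hR : IsClosedClass P R) {x : S} (hx : x ∈ R) :
    ∃ N, ∀ n ≥ N, period P R ∣ n → 0 < stepProb P n x x := by
  let A : AddSubmonoid ℕ :=
    { carrier := {n | 0 < stepProb P n x x}
      zero_mem' := stepProb_zero_pos.2 rfl
      add_mem' := fun ha hb => stepProb_add_pos ha hb }
  obtain ⟨hpos, hdvd, hle⟩ := hR.period_spec hP
  have hg : Nat.setGcd (A : Set ℕ) ∣ period P R := by
    have h1 : period P R ∣ Nat.setGcd (A : Set ℕ) :=
      Nat.dvd_setGcd_iff.2 fun n hn => hdvd x hx n hn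
    have h2 : Nat.setGcd (A : Set ℕ) ≤ period P R := by
      refine hle _ fun y hy n _ hn => ?_
      obtain ⟨a, ha⟩ := hR.accessible x hx y hy
      obtain ⟨b, hb⟩ := hR.accessible y hy x hx
      have h3 : Nat.setGcd (A : Set ℕ) ∣ a + b :=
        Nat.setGcd_dvd_of_mem (show a + b ∈ (A : Set ℕ) from stepProb_add_pos ha hb)
      have h4 : Nat.setGcd (A : Set ℕ) ∣ a + b + n := by
        refine Nat.setGcd_dvd_of_mem (show a + b + n ∈ (A : Set ℕ) from ?_)
        rw [add_right_comm]
        exact stepProb_add_pos (stepProb_add_pos ha hn) hb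
      exact (Nat.dvd_add_right h3).1 h4
    rcases Nat.eq_zero_or_pos (Nat.setGcd (A : Set ℕ)) with h0 | h0
    · obtain ⟨y, hxy⟩ := exists_pos_of_tsum_eq_one hP x
      obtain ⟨n, hn⟩ := hR.accessible y (hR.closed x hx y hxy) x hx
      have := Nat.setGcd_dvd_of_mem
        (show n + 1 ∈ (A : Set ℕ) from stepProb_succ_pos.2 ⟨y, hxy, hn⟩)
      rw [h0] at this
      exact absurd (Nat.eq_zero_of_zero_dvd this) n.succ_ne_zero
    · exact (le_antisymm h2 (Nat.le_of_dvd h0 h1)).dvd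
  obtain ⟨N, hN⟩ := Nat.exists_mem_closure_of_ge (A : Set ℕ)
  refine ⟨N, fun n hn hd => ?_⟩
  have := hN n hn (hg.trans hd)
  rwa [AddSubmonoid.closure_eq] at this

lemma IsCyclicDecomposition.stepProb_mem {R : Set S} (hR : IsClosedClass P R) {d : ℕ}
    {C : ZMod d → Set S} (hC : IsCyclicDecomposition P R d C) {n : ℕ} {x y : S} {j : ZMod d}
    (hx : x ∈ C j) (hxy : 0 < stepProb P n x y) : y ∈ C (j + n) := by
  induction n generalizing x j with
  | zero => rw [← stepProb_zero_pos.1 hxy]; simpa using hx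
  | succ n ih =>
    obtain ⟨z, hxz, hzy⟩ := stepProb_succ_pos.1 hxy
    have hxR : x ∈ R := hC.iUnion_eq ▸ Set.mem_iUnion_of_mem j hx
    have := ih (hC.step j x hx z (hR.closed x hxR z hxz) hxz) hzy
    convert this using 2
    push_cast
    ring

lemma IsCyclicDecomposition.index_eq {R : Set S} {d : ℕ} {C : ZMod d → Set S}
    (hC : IsCyclicDecomposition P R d C) {x : S} {j j' : ZMod d} (h : x ∈ C j) (h' : x ∈ C j') :
    j = j' := by
  by_contra hne
  exact Set.disjoint_left.1 (hC.disjoint j j' hne) h h'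

lemma IsCyclicDecomposition.exists_common_step (hP : ∀ a, ∑' b, P a b = 1) {R : Set S}
    (hR : IsClosedClass P R) {C : ZMod (period P R) → Set S}
    (hC : IsCyclicDecomposition P R (period P R) C) {x y : S} {j : ZMod (period P R)}
    (hx : x ∈ C j) (hy : y ∈ C j) :
    ∃ n, 0 < stepProb P n x x ∧ 0 < stepProb P n x y := by
  have hxR : x ∈ R := hC.iUnion_eq ▸ Set.mem_iUnion_of_mem j hx
  have hyR : y ∈ R := hC.iUnion_eq ▸ Set.mem_iUnion_of_mem j hy
  obtain ⟨a, ha⟩ := hR.accessible x hxR y hyR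
  have hda : period P R ∣ a := by
    rw [← ZMod.natCast_eq_zero_iff]
    simpa using hC.index_eq (hC.stepProb_mem hR hx ha) hy
  obtain ⟨N, hN⟩ := hR.exists_return hP hxR
  have hpos := (hR.period_spec hP).1
  have hle : N ≤ period P R * N := Nat.le_mul_of_pos_left N hpos
  exact ⟨period P R * N + a, hN _ (by omega) ((dvd_mul_right _ _).add hda),
    stepProb_add_pos (hN _ hle (dvd_mul_right _ _)) ha⟩

lemma IsCyclicDecomposition.nonempty (hP : ∀ a, ∑' b, P a b = 1) {R : Set S}
    (hR : IsClosedClass P R) {d : ℕ} (hd : 0 < d) {C : ZMod d → Set S}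
    (hC : IsCyclicDecomposition P R d C) (j : ZMod d) : (C j).Nonempty := by
  have : NeZero d := ⟨hd.ne'⟩
  obtain ⟨x, hx⟩ := hR.nonempty
  obtain ⟨j₀, hj₀⟩ := Set.mem_iUnion.1 (hC.iUnion_eq.symm ▸ hx : x ∈ ⋃ j, C j)
  have key : ∀ n : ℕ, (C (j₀ + n)).Nonempty := by
    intro n
    induction n with
    | zero => exact ⟨x, by simpa using hj₀⟩
    | succ n ih =>
      obtain ⟨y, hy⟩ := ih
      obtain ⟨z, hz⟩ := exists_pos_of_tsum_eq_one hP y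
      have hyR : y ∈ R := hC.iUnion_eq ▸ Set.mem_iUnion_of_mem _ hy
      refine ⟨z, ?_⟩
      have := hC.step _ y hy z (hR.closed y hyR z hz) hz
      rwa [add_assoc, ← Nat.cast_succ] at this
  simpa using key (j - j₀).val

lemma isCyclicDecomposition_of_irreducible (hP : ∀ a, ∑' b, P a b = 1)
    (hirr : ∀ x y, Accessible P x y) (x : S) :
    IsCyclicDecomposition P Set.univ (period P Set.univ)
      (fun j => {y | ∃ n : ℕ, 0 < stepProb P n x y ∧ (n : ZMod (period P Set.univ)) = j}) where
  iUnion_eq := Set.eq_univ_of_forall fun y =>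
    let ⟨n, hn⟩ := hirr x y
    Set.mem_iUnion.2 ⟨n, n, hn, rfl⟩
  disjoint := by
    intro j j' hne
    refine Set.disjoint_left.2 ?_
    rintro y ⟨n, hn, rfl⟩ ⟨n', hn', rfl⟩
    have hR : IsClosedClass P Set.univ :=
      ⟨⟨x, trivial⟩, fun _ _ _ _ => hirr _ _, fun _ _ _ _ => trivial⟩
    obtain ⟨b, hb⟩ := hirr y x
    have h := (hR.period_spec hP).2.1 x trivial
    have h1 := (ZMod.natCast_eq_zero_iff _ _).2 (h _ (stepProb_add_pos hn hb))
    have h2 := (ZMod.natCast_eq_zero_iff _ _).2 (h _ (stepProb_add_pos hn' hb))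
    rw [← h2] at h1
    push_cast at h1
    exact hne (add_right_cancel h1)
  step := by
    rintro j y ⟨n, hn, rfl⟩ z - hyz
    exact ⟨n + 1, stepProb_add_pos hn (stepProb_one_pos.2 hyz), by push_cast; rfl⟩

end Accessibility

/-! ### Orbits of the follow map -/

section Orbit

variable {S : Type u} {Ξ : Type v}

/-- The state at time `t + n` of the path started at the vertex `(t, x)`. -/
def orbit (h : S × Ξ → S) (ξ : ℤ → Ξ) (t : ℤ) (x : S) (n : ℕ) : S :=
  ((followMap h ξ)^[n] (t, x)).2

lemma iterate_followMap (h : S × Ξ → S) (ξ : ℤ → Ξ) (t : ℤ) (x : S) (n : ℕ) :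
    (followMap h ξ)^[n] (t, x) = (t + n, orbit h ξ t x n) := by
  refine Prod.ext ?_ rfl
  induction n with
  | zero => simp
  | succ n ih =>
    rw [Function.iterate_succ_apply']
    simp only [followMap] at ih ⊢
    rw [ih]
    push_cast
    ring

lemma orbit_zero (h : S × Ξ → S) (ξ : ℤ → Ξ) (t : ℤ) (x : S) : orbit h ξ t x 0 = x := rfl

lemma orbit_succ (h : S × Ξ → S) (ξ : ℤ → Ξ) (t : ℤ) (x : S) (n : ℕ) :
    orbit h ξ t x (n + 1) = h (orbit h ξ t x n, ξ (t + n)) := by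
  rw [orbit, Function.iterate_succ_apply', iterate_followMap]
  rfl

end Orbit

/-! ### The Markov property of orbits -/

section Markov

variable {S : Type u} [Countable S] [MeasurableSpace S] [DiscreteMeasurableSpace S]
  {Ξ : Type v} [MeasurableSpace Ξ] {Ω : Type w} [MeasurableSpace Ω]
  {μ : Measure Ω} [IsProbabilityMeasure μ] {h : S × Ξ → S} {ξ : ℤ → Ω → Ξ}

/-- The `σ`-algebra generated by the driving sequence strictly before time `t`. -/
@[reducible] def past (ξ : ℤ → Ω → Ξ) (t : ℤ) : MeasurableSpace Ω :=
  ⨆ s ∈ Set.Iio t, MeasurableSpace.comap (ξ s) inferInstance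


lemma past_le (hξ : ∀ t, Measurable (ξ t)) (t : ℤ) : past ξ t ≤ ‹MeasurableSpace Ω› :=
  iSup₂_le fun s _ => (hξ s).comap_le

lemma past_mono {s t : ℤ} (hst : s ≤ t) : past ξ s ≤ past ξ t :=
  biSup_mono fun _ hr => lt_of_lt_of_le hr hst

lemma measurable_past {s t : ℤ} (hst : s < t) : Measurable[past ξ t] (ξ s) :=
  Measurable.mono (comap_measurable (ξ s))
    (le_iSup₂_of_le (f := fun s (_ : s ∈ Set.Iio t) =>
      MeasurableSpace.comap (ξ s) inferInstance) s hst le_rfl) le_rfl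

lemma measurable_orbit_past (hh : Measurable h) (t : ℤ) (x : S) (n : ℕ) :
    Measurable[past ξ (t + n)] fun ω => orbit h (fun s => ξ s ω) t x n := by
  induction n with
  | zero => exact measurable_const
  | succ n ih =>
    simp_rw [orbit_succ]
    refine hh.comp (Measurable.prodMk (ih.mono (past_mono ?_) le_rfl) (measurable_past ?_)) <;>
    · push_cast; omega

lemma measurableSet_orbit_past (hh : Measurable h) {t r : ℤ} {n : ℕ} (hr : t + n ≤ r)
    (x : S) (A : Set S) :
    MeasurableSet[past ξ r] {ω | orbit h (fun s => ξ s ω) t x n ∈ A} :=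
  past_mono hr _ (measurable_orbit_past hh t x n (MeasurableSet.of_discrete (s := A)))

lemma measurable_orbit (hh : Measurable h) (hξ : ∀ t, Measurable (ξ t)) (t : ℤ) (x : S) (n : ℕ) :
    Measurable fun ω => orbit h (fun s => ξ s ω) t x n :=
  (measurable_orbit_past hh t x n).mono (past_le hξ _) le_rfl

lemma measurableSet_step (hh : Measurable h) (x y : S) :
    MeasurableSet {e : Ξ | h (x, e) = y} :=
  (hh.comp measurable_prodMk_left) (measurableSet_singleton y)

lemma measure_step (hh : Measurable h) (hfull : FullyIndependentTransitions h ξ μ) (t : ℤ)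
    (x y : S) : μ {ω | h (x, ξ t ω) = y} = transition h ξ μ x y :=
  (hfull.identDistrib t).measure_mem_eq (measurableSet_step hh x y)

lemma measure_past_inter (hξ : ∀ t, Measurable (ξ t))
    (hfull : FullyIndependentTransitions h ξ μ) {t : ℤ} {A : Set Ω}
    (hA : MeasurableSet[past ξ t] A) {B : Set Ξ} (hB : MeasurableSet B) :
    μ (A ∩ ξ t ⁻¹' B) = μ A * μ (ξ t ⁻¹' B) := by
  have hi := indep_iSup_of_disjoint (fun s => (hξ s).comap_le) hfull.indep.iIndep
    (S := Set.Iio t) (T := {t}) (by simp)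
  refine Indep_iff .. |>.1 hi A (ξ t ⁻¹' B) hA ?_
  rw [iSup_singleton]
  exact ⟨B, hB, rfl⟩

lemma measure_past_inter_step (hh : Measurable h) (hξ : ∀ t, Measurable (ξ t))
    (hfull : FullyIndependentTransitions h ξ μ) {t : ℤ} {A : Set Ω}
    (hA : MeasurableSet[past ξ t] A) (x y : S) :
    μ (A ∩ {ω | h (x, ξ t ω) = y}) = μ A * transition h ξ μ x y := by
  rw [← measure_step hh hfull t]
  exact measure_past_inter hξ hfull hA (measurableSet_step hh x y)

lemma measure_step_pair (hh : Measurable h) (hfull : FullyIndependentTransitions h ξ μ) (t : ℤ)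
    {x y : S} (hxy : x ≠ y) (x' y' : S) :
    μ ({ω | h (x, ξ t ω) = x'} ∩ {ω | h (y, ξ t ω) = y'})
      = transition h ξ μ x x' * transition h ξ μ y y' := by
  have hi := ((hfull.vertical t).indepFun hxy).measure_inter_preimage_eq_mul
    {(t + 1, x')} {(t + 1, y')} (measurableSet_singleton _) (measurableSet_singleton _)
  rw [← measure_step hh hfull t, ← measure_step hh hfull t]
  simpa [Set.preimage, followMap, Prod.ext_iff] using hi

lemma measure_past_inter_step_pair (hh : Measurable h) (hξ : ∀ t, Measurable (ξ t))
    (hfull : FullyIndependentTransitions h ξ μ) {t : ℤ} {A : Set Ω}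
    (hA : MeasurableSet[past ξ t] A) {x y : S} (hxy : x ≠ y) (x' y' : S) :
    μ (A ∩ ({ω | h (x, ξ t ω) = x'} ∩ {ω | h (y, ξ t ω) = y'}))
      = μ A * (transition h ξ μ x x' * transition h ξ μ y y') := by
  rw [← measure_step_pair hh hfull t hxy]
  exact measure_past_inter hξ hfull hA
    ((measurableSet_step hh x x').inter (measurableSet_step hh y y'))

lemma measure_eq_tsum_fiber {β : Type*} [Countable β] {X : Ω → β} {A : Set Ω}
    (hA : ∀ z, MeasurableSet (A ∩ {ω | X ω = z})) : μ A = ∑' z, μ (A ∩ {ω | X ω = z}) := by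
  rw [← measure_iUnion _ hA, ← Set.inter_iUnion]
  · congr 1; ext ω; simp
  · intro z w hzw
    refine Set.disjoint_left.2 ?_
    rintro ω ⟨_, rfl⟩ ⟨_, rfl⟩
    exact hzw rfl

lemma tsum_transition (hh : Measurable h) (hξ : ∀ t, Measurable (ξ t)) (x : S) :
    ∑' y, transition h ξ μ x y = 1 := by
  rw [← measure_univ (μ := μ), measure_eq_tsum_fiber (X := fun ω => h (x, ξ 0 ω)) fun y => ?_]
  · simp [transition]
  · rw [Set.univ_inter]
    exact hξ 0 (measurableSet_step hh x y)

/-- Almost surely, every edge of the graph is a transition of positive probability. -/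
lemma ae_transition_pos (hh : Measurable h) (hfull : FullyIndependentTransitions h ξ μ) :
    ∀ᵐ ω ∂μ, ∀ (t : ℤ) (x : S), 0 < transition h ξ μ x (h (x, ξ t ω)) := by
  have h1 : ∀ᵐ ω ∂μ, ∀ (t : ℤ) (x y : S), h (x, ξ t ω) = y → 0 < transition h ξ μ x y := by
    refine ae_all_iff.2 fun t => ae_all_iff.2 fun x => ae_all_iff.2 fun y => ?_
    rcases eq_or_ne (transition h ξ μ x y) 0 with h0 | h0
    · have h2 : μ {ω | h (x, ξ t ω) = y} = 0 := by rw [measure_step hh hfull, h0]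
      filter_upwards [measure_eq_zero_iff_ae_notMem.1 h2] with ω hω hy
      exact absurd hy hω
    · exact ae_of_all _ fun _ _ => pos_iff_ne_zero.2 h0
  filter_upwards [h1] with ω hω t x using hω t x _ rfl

/-- The states along the path of a vertex form a Markov chain. -/
lemma isMarkovChain_orbit (hh : Measurable h) (hξ : ∀ t, Measurable (ξ t))
    (hfull : FullyIndependentTransitions h ξ μ) (t : ℤ) (x : S) :
    IsMarkovChain (transition h ξ μ) μ fun n ω => orbit h (fun s => ξ s ω) t x n where
  measurable := measurable_orbit hh hξ t x
  markov n y := by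
    rw [← measure_past_inter_step hh hξ hfull (t := t + n)
      (A := {ω | ∀ k ≤ n, orbit h (fun s => ξ s ω) t x k = y k})]
    · congr 1
      ext ω
      simp only [Set.mem_ofPred_eq, Set.mem_inter_iff]
      constructor
      · intro hk
        refine ⟨fun k hkn => hk k (by omega), ?_⟩
        rw [← hk (n + 1) le_rfl, orbit_succ, hk n (by omega)]
      · rintro ⟨hk, hstep⟩ k hkn
        rcases Nat.lt_or_eq_of_le hkn with hlt | rfl
        · exact hk k (by omega)
        · rw [orbit_succ, hk n le_rfl, hstep]
    · simp only [Set.ofPred_forall]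
      exact MeasurableSet.iInter fun k => MeasurableSet.iInter fun hk =>
        measurableSet_orbit_past hh (by omega) x {y k}

end Markov

/-! ### Positive recurrence and invariant measures -/

section PositiveRecurrence

variable {S : Type u} [Countable S] [MeasurableSpace S] [DiscreteMeasurableSpace S]
  {Ξ : Type v} [MeasurableSpace Ξ] {Ω : Type w} [MeasurableSpace Ω]
  {μ : Measure Ω} [IsProbabilityMeasure μ] {h : S × Ξ → S} {ξ : ℤ → Ω → Ξ}

/-- The event that the path of `(0, x)` does not return to `x` at the times `1, …, n`. -/
def noReturn (h : S × Ξ → S) (ξ : ℤ → Ω → Ξ) (x : S) (n : ℕ) : Set Ω :=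
  {ω | ∀ k, 1 ≤ k → k ≤ n → orbit h (fun s => ξ s ω) 0 x k ≠ x}

lemma measurableSet_noReturn_past (hh : Measurable h) (x : S) (n : ℕ) :
    MeasurableSet[past ξ (0 + n)] (noReturn h ξ x n) := by
  simp only [noReturn, Set.ofPred_forall]
  exact MeasurableSet.iInter fun k => MeasurableSet.iInter fun _ => MeasurableSet.iInter fun hk =>
    measurableSet_orbit_past hh (by omega) x {x}ᶜ

lemma tsum_indicator_noReturn_le (h : S × Ξ → S) (ξ : ℤ → Ω → Ξ) (x : S) (ω : Ω) :
    ∑' n, (noReturn h ξ x n).indicator (fun _ => (1 : ℝ≥0∞)) ω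
      ≤ (returnTime h (fun s => ξ s ω) 0 x x : ℝ≥0∞) := by
  by_cases hex : ∃ n, 1 ≤ n ∧ orbit h (fun s => ξ s ω) 0 x n = x
  · classical
    have hτ : returnTime h (fun s => ξ s ω) 0 x x = (Nat.find hex : ℕ∞) := by
      refine le_antisymm (iInf₂_le (Nat.find hex) (Nat.find_spec hex)) (le_iInf₂ fun n hn => ?_)
      exact_mod_cast Nat.find_min' hex hn
    rw [hτ, tsum_eq_sum (s := Finset.range (Nat.find hex))]
    · refine (Finset.sum_le_card_nsmul _ _ 1 fun n _ => ?_).trans (by simp)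
      exact Set.indicator_le_self' (fun _ _ => zero_le) _ |>.trans le_rfl
    · intro n hn
      refine Set.indicator_of_notMem (fun hω => ?_) _
      exact hω _ (Nat.find_spec hex).1 (by simpa using hn) (Nat.find_spec hex).2
  · have hτ : returnTime h (fun s => ξ s ω) 0 x x = ⊤ :=
      iInf₂_eq_top.2 fun n hn => absurd ⟨n, hn⟩ hex
    simp [hτ]

lemma IsPositiveRecurrent.tsum_noReturn_ne_top (hh : Measurable h) (hξ : ∀ t, Measurable (ξ t))
    {x : S} (hx : IsPositiveRecurrent h ξ μ x) : ∑' n, μ (noReturn h ξ x n) ≠ ∞ := by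
  have hmeas : ∀ n, MeasurableSet (noReturn h ξ x n) := fun n =>
    past_le hξ _ _ (measurableSet_noReturn_past hh x n)
  have h1 : ∑' n, μ (noReturn h ξ x n)
      = ∫⁻ ω, ∑' n, (noReturn h ξ x n).indicator (fun _ => (1 : ℝ≥0∞)) ω ∂μ := by
    rw [lintegral_tsum fun n => (measurable_const.indicator (hmeas n)).aemeasurable]
    simp [lintegral_indicator, hmeas]
  rw [h1]
  exact ((lintegral_mono (tsum_indicator_noReturn_le h ξ x)).trans_lt hx).ne

lemma IsPositiveRecurrent.isRecurrent (hh : Measurable h) (hξ : ∀ t, Measurable (ξ t))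
    {x : S} (hx : IsPositiveRecurrent h ξ μ x) : IsRecurrent h ξ μ x := by
  have h1 := measure_limsup_atTop_eq_zero (hx.tsum_noReturn_ne_top hh hξ)
  filter_upwards [measure_eq_zero_iff_ae_notMem.1 h1] with ω hω
  by_contra htop
  refine hω ?_
  have hall : ∀ n, ω ∈ noReturn h ξ x n := fun n k hk _ hkx =>
    htop (lt_of_le_of_lt (iInf₂_le k ⟨hk, hkx⟩) (ENat.natCast_lt_top k))
  simpa [Filter.limsup_eq_iInf_iSup_of_nat, hall] using fun i => ⟨i, le_rfl⟩

/-- A positive recurrent state is charged by a finite invariant measure. -/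
lemma IsPositiveRecurrent.exists_invariant (hh : Measurable h) (hξ : ∀ t, Measurable (ξ t))
    (hfull : FullyIndependentTransitions h ξ μ) {x : S} (hx : IsPositiveRecurrent h ξ μ x) :
    ∃ m : S → ℝ≥0∞, (∀ y, ∑' z, m z * transition h ξ μ z y = m y) ∧ ∑' y, m y ≠ ∞ ∧ m x = 1 := by
  have hmeas : ∀ (n : ℕ) (z : S), MeasurableSet[past ξ (0 + n)]
      (noReturn h ξ x n ∩ {ω | orbit h (fun s => ξ s ω) 0 x n = z}) := fun n z =>
    (measurableSet_noReturn_past hh x n).inter (measurableSet_orbit_past hh le_rfl x {z})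
  refine tsum_taboo_invariant (tsum_transition hh hξ) (x := x)
    (a := fun n y => μ (noReturn h ξ x n ∩ {ω | orbit h (fun s => ξ s ω) 0 x n = y}))
    ?_ ?_ ?_ ?_ ?_
  · intro y hy
    simp [orbit_zero, hy.symm]
  · have : noReturn h ξ x 0 = Set.univ := Set.eq_univ_of_forall fun ω k hk hk' => by omega
    simp [orbit_zero, this]
  · intro n
    convert measure_empty (μ := μ)
    refine Set.eq_empty_of_forall_notMem ?_
    rintro ω ⟨hω, hω'⟩
    exact hω (n + 1) (by omega) le_rfl hω'
  · intro n y hy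
    have hm : ∀ z, MeasurableSet (noReturn h ξ x (n + 1) ∩
        {ω | orbit h (fun s => ξ s ω) 0 x (n + 1) = y} ∩
        {ω | orbit h (fun s => ξ s ω) 0 x n = z}) := fun z =>
      ((past_le hξ _ _ (hmeas (n + 1) y))).inter
        (measurable_orbit hh hξ 0 x n (measurableSet_singleton z))
    rw [measure_eq_tsum_fiber hm]
    refine tsum_congr fun z => ?_
    rw [← measure_past_inter_step hh hξ hfull (hmeas n z)]
    congr 1
    ext ω
    simp only [noReturn, Set.mem_inter_iff, Set.mem_ofPred_eq, orbit_succ]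
    constructor
    · rintro ⟨⟨h1, h2⟩, rfl⟩
      exact ⟨⟨fun k hk hkn => h1 k hk (by omega), rfl⟩, h2⟩
    · rintro ⟨⟨h1, rfl⟩, h2⟩
      refine ⟨⟨fun k hk hkn => ?_, h2⟩, rfl⟩
      rcases Nat.lt_or_eq_of_le hkn with hlt | rfl
      · exact h1 k hk (by omega)
      · rw [orbit_succ, h2]; exact hy
  · refine ne_of_eq_of_ne (tsum_congr fun n => ?_) (hx.tsum_noReturn_ne_top hh hξ)
    exact (measure_eq_tsum_fiber fun z => past_le hξ _ _ (hmeas n z)).symm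

lemma IsPositiveRecurrent.isClosedClass (hh : Measurable h) (hξ : ∀ t, Measurable (ξ t))
    (hfull : FullyIndependentTransitions h ξ μ) {x : S} (hx : IsPositiveRecurrent h ξ μ x) :
    IsClosedClass (transition h ξ μ) (commClass (transition h ξ μ) x) := by
  obtain ⟨m, hm, hfin, hmx⟩ := hx.exists_invariant hh hξ hfull
  refine ⟨⟨x, mem_commClass_self x⟩, fun y hy z hz => hy.2.trans hz.1, fun y hy z hyz => ?_⟩
  have hxz := hy.1.trans (.of_pos hyz)
  exact ⟨hxz, accessible_symm_of_invariant (tsum_transition hh hξ) hm hfin (by simp [hmx]) hxz⟩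

end PositiveRecurrence

/-! ### Coalescence -/

section Coalescence

variable {S : Type u} [Countable S] [MeasurableSpace S] [DiscreteMeasurableSpace S]
  {Ξ : Type v} [MeasurableSpace Ξ] {Ω : Type w} [MeasurableSpace Ω]
  {μ : Measure Ω} [IsProbabilityMeasure μ] {h : S × Ξ → S} {ξ : ℤ → Ω → Ξ}

/-- The event that the paths of `(t, x)` and `(t, y)` differ at the times `t, …, t + n`. -/
def notMerged (h : S × Ξ → S) (ξ : ℤ → Ω → Ξ) (t : ℤ) (x y : S) (n : ℕ) : Set Ω :=
  {ω | ∀ k ≤ n, orbit h (fun s => ξ s ω) t x k ≠ orbit h (fun s => ξ s ω) t y k}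

/-- The event that the two paths have not merged by time `t + n` and are then at `p`. -/
def notMergedAt (h : S × Ξ → S) (ξ : ℤ → Ω → Ξ) (t : ℤ) (x y : S) (n : ℕ) (p : S × S) : Set Ω :=
  notMerged h ξ t x y n ∩
    {ω | (orbit h (fun s => ξ s ω) t x n, orbit h (fun s => ξ s ω) t y n) = p}

lemma measurableSet_notMergedAt_past (hh : Measurable h) (t : ℤ) (x y : S) (n : ℕ) (p : S × S) :
    MeasurableSet[past ξ (t + n)] (notMergedAt h ξ t x y n p) := by
  have hpair : ∀ k ≤ n, Measurable[past ξ (t + n)]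
      fun ω => (orbit h (fun s => ξ s ω) t x k, orbit h (fun s => ξ s ω) t y k) := fun k hk =>
    ((measurable_orbit_past hh t x k).mono (past_mono (by omega)) le_rfl).prodMk
      ((measurable_orbit_past hh t y k).mono (past_mono (by omega)) le_rfl)
  simp only [notMergedAt, notMerged, Set.ofPred_forall]
  refine MeasurableSet.inter (MeasurableSet.iInter fun k => MeasurableSet.iInter fun hk => ?_)
    (hpair n le_rfl (measurableSet_singleton p))
  exact hpair k hk (MeasurableSet.of_discrete (s := (Set.diagonal S)ᶜ))

lemma measure_notMergedAt_succ_le (hh : Measurable h) (hξ : ∀ t, Measurable (ξ t))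
    (hfull : FullyIndependentTransitions h ξ μ) (t : ℤ) (x y : S) (n : ℕ) (q : S × S) :
    μ (notMergedAt h ξ t x y (n + 1) q) ≤ ∑' p, μ (notMergedAt h ξ t x y n p) *
      (transition h ξ μ p.1 q.1 * transition h ξ μ p.2 q.2) := by
  have hm : ∀ p : S × S, MeasurableSet (notMergedAt h ξ t x y (n + 1) q ∩
      {ω | (orbit h (fun s => ξ s ω) t x n, orbit h (fun s => ξ s ω) t y n) = p}) := fun p =>
    (past_le hξ _ _ (measurableSet_notMergedAt_past hh t x y (n + 1) q)).inter
      (((measurable_orbit hh hξ t x n).prodMk (measurable_orbit hh hξ t y n))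
        (measurableSet_singleton p))
  rw [measure_eq_tsum_fiber hm]
  refine ENNReal.tsum_le_tsum ?_
  rintro ⟨z, w⟩
  by_cases hzw : z = w
  · refine le_of_eq_of_le ?_ zero_le
    convert measure_empty (μ := μ)
    refine Set.eq_empty_of_forall_notMem ?_
    rintro ω ⟨⟨h1, -⟩, h2⟩
    rw [Set.mem_ofPred_eq, Prod.mk.injEq] at h2
    exact h1 n (by omega) (by rw [h2.1, h2.2, hzw])
  · rw [← measure_past_inter_step_pair hh hξ hfull
      (measurableSet_notMergedAt_past hh t x y n (z, w)) hzw]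
    refine measure_mono ?_
    rintro ω ⟨⟨h1, h2⟩, h3⟩
    refine ⟨⟨fun k hk => h1 k (by omega), h3⟩, ?_⟩
    simp only [Set.mem_ofPred_eq, Prod.mk.injEq] at h3
    simp only [Set.mem_ofPred_eq, orbit_succ, h3.1, h3.2] at h2
    simp [← h2]

lemma measure_notMerged_le_avoidProb (hh : Measurable h) (hξ : ∀ t, Measurable (ξ t))
    (hfull : FullyIndependentTransitions h ξ μ) (t : ℤ) (x y : S) (n : ℕ) :
    μ (notMerged h ξ t x y n) ≤ avoidProb
      (fun a b : S × S => transition h ξ μ a.1 b.1 * transition h ξ μ a.2 b.2)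
      (Set.diagonal S) n (x, y) := by
  set Q : S × S → S × S → ℝ≥0∞ :=
    fun a b => transition h ξ μ a.1 b.1 * transition h ξ μ a.2 b.2 with hQ
  have hdiag : ∀ n (p : S × S), p ∈ Set.diagonal S → μ (notMergedAt h ξ t x y n p) = 0 := by
    rintro n ⟨a, b⟩ hp
    convert measure_empty (μ := μ)
    refine Set.eq_empty_of_forall_notMem ?_
    rintro ω ⟨h1, h2⟩
    rw [Set.mem_ofPred_eq, Prod.mk.injEq] at h2
    exact h1 n le_rfl (by rw [h2.1, h2.2]; exact hp)
  have hstep : ∀ n k, ∑' p, μ (notMergedAt h ξ t x y (n + 1) p) * avoidProb Q (Set.diagonal S) k p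
      ≤ ∑' p, μ (notMergedAt h ξ t x y n p) * avoidProb Q (Set.diagonal S) (k + 1) p := by
    intro n k
    calc _ ≤ ∑' q, (∑' p, μ (notMergedAt h ξ t x y n p) * Q p q) *
            avoidProb Q (Set.diagonal S) k q :=
          ENNReal.tsum_le_tsum fun q => mul_le_mul_left
            (measure_notMergedAt_succ_le hh hξ hfull t x y n q) _
      _ = ∑' p, μ (notMergedAt h ξ t x y n p) *
            ∑' q, Q p q * avoidProb Q (Set.diagonal S) k q := by
          simp_rw [← ENNReal.tsum_mul_right, ← ENNReal.tsum_mul_left, mul_assoc]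
          exact ENNReal.tsum_comm
      _ ≤ _ := by
          refine ENNReal.tsum_le_tsum fun p => ?_
          by_cases hp : p ∈ Set.diagonal S
          · simp [hdiag n p hp]
          · rw [avoidProb_succ_of_notMem Q k hp]
  have hall : ∀ n k, ∑' p, μ (notMergedAt h ξ t x y n p) * avoidProb Q (Set.diagonal S) k p
      ≤ avoidProb Q (Set.diagonal S) (n + k) (x, y) := by
    intro n
    induction n with
    | zero =>
      intro k
      rw [tsum_eq_single (x, y), zero_add]
      · exact mul_le_of_le_one_left' prob_le_one
      · intro p hp
        simp [notMergedAt, orbit_zero, hp.symm]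
    | succ n ih =>
      intro k
      rw [Nat.add_right_comm]
      exact (hstep n k).trans (ih (k + 1))
  calc μ (notMerged h ξ t x y n) = ∑' p, μ (notMergedAt h ξ t x y n p) :=
        measure_eq_tsum_fiber fun p =>
          past_le hξ _ _ (measurableSet_notMergedAt_past hh t x y n p)
    _ ≤ ∑' p, μ (notMergedAt h ξ t x y n p) * avoidProb Q (Set.diagonal S) 0 p := by
        refine ENNReal.tsum_le_tsum fun p => ?_
        by_cases hp : p ∈ Set.diagonal S
        · simp [hdiag n p hp]
        · simp [avoidProb, hp]
    _ ≤ _ := hall n 0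

/-- Paths started at the same time in the same cyclic class of a positive recurrent class almost
surely merge. -/
lemma ae_exists_orbit_eq (hh : Measurable h) (hξ : ∀ t, Measurable (ξ t))
    (hfull : FullyIndependentTransitions h ξ μ) {x y : S} (hx : IsPositiveRecurrent h ξ μ x)
    {n : ℕ} (hxx : 0 < stepProb (transition h ξ μ) n x x)
    (hxy : 0 < stepProb (transition h ξ μ) n x y) (t : ℤ) :
    ∀ᵐ ω ∂μ, ∃ k, orbit h (fun s => ξ s ω) t x k = orbit h (fun s => ξ s ω) t y k := by
  obtain ⟨m, hm, hfin, hmx⟩ := hx.exists_invariant hh hξ hfull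
  have h0 := iInf_avoidProb_diagonal_eq_zero (tsum_transition hh hξ) hm hfin (x := x)
    (by simp [hmx]) hxx hxy
  have h1 : μ (⋂ n, notMerged h ξ t x y n) = 0 := by
    rw [← nonpos_iff_eq_zero, ← h0]
    exact le_iInf fun k => (measure_mono (Set.iInter_subset _ k)).trans
      (measure_notMerged_le_avoidProb hh hξ hfull t x y k)
  filter_upwards [measure_eq_zero_iff_ae_notMem.1 h1] with ω hω
  by_contra! hne
  exact hω (Set.mem_iInter.2 fun n k _ => hne k)

end Coalescence

/-! ### Components of the graph of one realization -/

section Components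

variable {S : Type u} {Ξ : Type v} {h : S × Ξ → S} {ξ : ℤ → Ξ}

lemma graph_adj_followMap (p : ℤ × S) : (graph h ξ).Adj p (followMap h ξ p) := by
  refine (SimpleGraph.fromRel_adj _ _ _).2 ⟨fun hp => ?_, Or.inl rfl⟩
  have := congrArg Prod.fst hp
  simp [followMap] at this

lemma reachable_iterate (p : ℤ × S) (n : ℕ) :
    (graph h ξ).Reachable p ((followMap h ξ)^[n] p) := by
  induction n with
  | zero => exact .rfl
  | succ n ih =>
    rw [Function.iterate_succ_apply']
    exact ih.trans (graph_adj_followMap _).reachable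

/-- Two vertices are in the same component if and only if their paths merge. -/
lemma reachable_iff {p q : ℤ × S} : (graph h ξ).Reachable p q ↔
    ∃ m n : ℕ, (followMap h ξ)^[m] p = (followMap h ξ)^[n] q := by
  constructor
  · rintro ⟨W⟩
    induction W with
    | nil => exact ⟨0, 0, rfl⟩
    | @cons a b c hab _ ih =>
      obtain ⟨m, n, hmn⟩ := ih
      rcases ((SimpleGraph.fromRel_adj _ _ _).1 hab).2 with rfl | rfl
      · exact ⟨m + 1, n, hmn⟩
      · refine ⟨m, n + 1, ?_⟩
        rw [← Function.iterate_succ_apply, Function.iterate_succ_apply' _ m, hmn,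
          ← Function.iterate_succ_apply' (followMap h ξ)]
  · rintro ⟨m, n, hmn⟩
    exact (reachable_iterate p m).trans (hmn ▸ (reachable_iterate q n).symm)

lemma fst_iterate_followMap (p : ℤ × S) (n : ℕ) : ((followMap h ξ)^[n] p).1 = p.1 + n := by
  rw [← Prod.mk.eta (p := p), iterate_followMap]

lemma IsStatePath.eq_iterate {I : Set ℤ} {X : ℤ → S} (hX : IsStatePath h ξ I X) {t : ℤ}
    (ht : t ∈ I) (n : ℕ) (hn : t + n ∈ I) :
    (followMap h ξ)^[n] (t, X t) = (t + n, X (t + n)) := by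
  induction n with
  | zero => simp
  | succ n ih =>
    have hmem : t + n ∈ I := hX.interval.out ht hn ⟨by omega, by push_cast; omega⟩
    have hcast : t + ((n + 1 : ℕ) : ℤ) = t + n + 1 := by push_cast; ring
    rw [hcast] at hn ⊢
    rw [Function.iterate_succ_apply', ih hmem]
    exact hX.edge _ hmem hn

lemma IsStatePath.reachable {I : Set ℤ} {X : ℤ → S} (hX : IsStatePath h ξ I X) {s t : ℤ}
    (hs : s ∈ I) (ht : t ∈ I) : (graph h ξ).Reachable (s, X s) (t, X t) := by
  wlog hst : s ≤ t generalizing s t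
  · exact (this ht hs (le_of_not_ge hst)).symm
  obtain ⟨n, rfl⟩ := Int.le.dest hst
  rw [← hX.eq_iterate hs n ht]
  exact reachable_iterate _ n

/-- The path of a vertex, indexed by time. -/
lemma isStatePath_forward (p : ℤ × S) :
    IsStatePath h ξ (Set.Ici p.1) fun s => ((followMap h ξ)^[(s - p.1).toNat] p).2 where
  interval := Set.ordConnected_Ici
  edge s hs _ := by
    have hs' : p.1 ≤ s := hs
    have h1 : ((followMap h ξ)^[(s - p.1).toNat] p).1 = s := by
      rw [fst_iterate_followMap]; omega
    have h2 : (s + 1 - p.1).toNat = (s - p.1).toNat + 1 := by omega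
    have h3 : (s, ((followMap h ξ)^[(s - p.1).toNat] p).2)
        = (followMap h ξ)^[(s - p.1).toNat] p := Prod.ext h1.symm rfl
    rw [h3, h2, Function.iterate_succ_apply']
    exact Prod.ext (by simp [followMap, h1]) rfl

variable {ι : Type*} {d : ι → ℕ} {C : (i : ι) → ZMod (d i) → Set S}

/-- The state of the vertex `q = (t, x)` lies in the class `C i (j + t)`, where `l = (i, j)`. -/
def InPhase (C : (i : ι) → ZMod (d i) → Set S) (l : (i : ι) × ZMod (d i)) (q : ℤ × S) : Prop :=
  q.2 ∈ C l.1 (l.2 + (q.1 : ZMod (d l.1)))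

/-- The path of `p` is eventually in phase `l`. -/
def HasLabel (h : S × Ξ → S) (ξ : ℤ → Ξ) (C : (i : ι) → ZMod (d i) → Set S)
    (l : (i : ι) × ZMod (d i)) (p : ℤ × S) : Prop :=
  ∀ᶠ n : ℕ in Filter.atTop, InPhase C l ((followMap h ξ)^[n] p)

/-- What holds for almost every realization: paths move cyclically through the classes, reach
them, and merge when started simultaneously in the same class. -/
structure IsRegularRealization (h : S × Ξ → S) (ξ : ℤ → Ξ)
    (C : (i : ι) → ZMod (d i) → Set S) : Prop where
  step : ∀ i j t, ∀ x ∈ C i j, h (x, ξ t) ∈ C i (j + 1)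
  hits : ∀ p, ∃ n i j, ((followMap h ξ)^[n] p).2 ∈ C i j
  merge : ∀ i j t, ∀ x ∈ C i j, ∀ y ∈ C i j, ∃ n, orbit h ξ t x n = orbit h ξ t y n

lemma hasLabel_iterate_iff {l : (i : ι) × ZMod (d i)} {p : ℤ × S} (m : ℕ) :
    HasLabel h ξ C l ((followMap h ξ)^[m] p) ↔ HasLabel h ξ C l p := by
  simp only [HasLabel, ← Function.iterate_add_apply]
  conv_rhs => rw [← Filter.map_add_atTop_eq_nat m, Filter.eventually_map]

lemma hasLabel_congr_of_reachable {l : (i : ι) × ZMod (d i)} {p q : ℤ × S}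
    (hpq : (graph h ξ).Reachable p q) : HasLabel h ξ C l p ↔ HasLabel h ξ C l q := by
  obtain ⟨m, n, hmn⟩ := reachable_iff.1 hpq
  rw [← hasLabel_iterate_iff m, hmn, hasLabel_iterate_iff]

lemma HasLabel.unique
    (huniq : ∀ i j i' j', (C i j ∩ C i' j').Nonempty →
      (⟨i, j⟩ : (i : ι) × ZMod (d i)) = ⟨i', j'⟩)
    {l l' : (i : ι) × ZMod (d i)} {p : ℤ × S} (hl : HasLabel h ξ C l p)
    (hl' : HasLabel h ξ C l' p) : l = l' := by
  obtain ⟨n, hn, hn'⟩ := (hl.and hl').exists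
  obtain ⟨i, j⟩ := l
  obtain ⟨i', j'⟩ := l'
  have := huniq _ _ _ _ ⟨_, hn, hn'⟩
  simp only [Sigma.mk.injEq] at this
  obtain ⟨rfl, h2⟩ := this
  rw [add_right_cancel (eq_of_heq h2)]

lemma IsRegularRealization.hasLabel_of_inPhase (hreg : IsRegularRealization h ξ C)
    {l : (i : ι) × ZMod (d i)} {p : ℤ × S} (hp : InPhase C l p) : HasLabel h ξ C l p := by
  refine Filter.Eventually.of_forall fun n => ?_
  induction n with
  | zero => exact hp
  | succ n ih =>
    rw [Function.iterate_succ_apply']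
    have := hreg.step _ _ ((followMap h ξ)^[n] p).1 _ ih
    rw [add_assoc] at this
    simpa [InPhase, followMap] using this

lemma IsRegularRealization.hasLabel_of_mem (hreg : IsRegularRealization h ξ C)
    {i : ι} {j : ZMod (d i)} {p : ℤ × S} (hp : p.2 ∈ C i j) :
    HasLabel h ξ C ⟨i, j - (p.1 : ZMod (d i))⟩ p :=
  hreg.hasLabel_of_inPhase (by simpa [InPhase] using hp)

lemma IsRegularRealization.exists_hasLabel (hreg : IsRegularRealization h ξ C) (p : ℤ × S) :
    ∃ l, HasLabel h ξ C l p := by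
  obtain ⟨n, i, j, hn⟩ := hreg.hits p
  exact ⟨_, (hasLabel_iterate_iff n).1 (hreg.hasLabel_of_mem hn)⟩

lemma IsRegularRealization.reachable_of_hasLabel (hreg : IsRegularRealization h ξ C)
    {l : (i : ι) × ZMod (d i)} {p q : ℤ × S} (hp : HasLabel h ξ C l p)
    (hq : HasLabel h ξ C l q) : (graph h ξ).Reachable p q := by
  obtain ⟨N, hN⟩ := Filter.eventually_atTop.1 (hp.and hq)
  set m := N + (q.1 - p.1).toNat with hm
  set n := N + (p.1 - q.1).toNat with hn
  have htime : ((followMap h ξ)^[m] p).1 = ((followMap h ξ)^[n] q).1 := by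
    rw [fst_iterate_followMap, fst_iterate_followMap]; omega
  have h1 := (hN m (by omega)).1
  have h2 := (hN n (by omega)).2
  unfold InPhase at h1 h2
  rw [htime] at h1
  obtain ⟨k, hk⟩ := hreg.merge _ _ ((followMap h ξ)^[n] q).1 _ h1 _ h2
  refine (reachable_iterate p m).trans (.trans ?_ (reachable_iterate q n).symm)
  refine reachable_iff.2 ⟨k, k, ?_⟩
  generalize (followMap h ξ)^[m] p = a at *
  generalize (followMap h ξ)^[n] q = b at *
  rw [← Prod.mk.eta (p := a), ← Prod.mk.eta (p := b), htime, iterate_followMap,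
    iterate_followMap, hk]

/-- The components of a regular realization are in bijection with the cyclic classes. -/
lemma IsRegularRealization.exists_equiv (hreg : IsRegularRealization h ξ C)
    (huniq : ∀ i j i' j', (C i j ∩ C i' j').Nonempty →
      (⟨i, j⟩ : (i : ι) × ZMod (d i)) = ⟨i', j'⟩)
    (hne : ∀ i j, (C i j).Nonempty) :
    ∃ K : ((i : ι) × ZMod (d i)) ≃ (graph h ξ).ConnectedComponent,
      ∀ l p, p ∈ (K l).supp ↔ HasLabel h ξ C l p := by
  have hrep : ∀ l : (i : ι) × ZMod (d i), ∃ p : ℤ × S, HasLabel h ξ C l p := by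
    rintro ⟨i, j⟩
    obtain ⟨x, hx⟩ := hne i j
    exact ⟨(0, x), hreg.hasLabel_of_inPhase (by simpa [InPhase] using hx)⟩
  choose rep hrep using hrep
  have hiff : ∀ l p, (graph h ξ).Reachable p (rep l) ↔ HasLabel h ξ C l p := fun l p =>
    ⟨fun hr => (hasLabel_congr_of_reachable hr).2 (hrep l),
      fun hl => hreg.reachable_of_hasLabel hl (hrep l)⟩
  refine ⟨Equiv.ofBijective (fun l => (graph h ξ).connectedComponentMk (rep l)) ⟨?_, ?_⟩, ?_⟩
  · intro l l' hll
    exact ((hiff l' (rep l)).1 (SimpleGraph.ConnectedComponent.eq.1 hll)).unique huniq (hrep l)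
      |>.symm
  · intro c
    induction c using SimpleGraph.ConnectedComponent.ind with
    | _ p =>
      obtain ⟨l, hl⟩ := hreg.exists_hasLabel p
      exact ⟨l, SimpleGraph.ConnectedComponent.eq.2 ((hiff l p).2 hl).symm⟩
  · intro l p
    rw [← hiff, SimpleGraph.ConnectedComponent.mem_supp_iff]
    exact SimpleGraph.ConnectedComponent.eq

/-- The vertices with a given label are those on the paths through `C i j` at a multiple of the
period. -/
lemma IsRegularRealization.hasLabel_iff_exists_path (hreg : IsRegularRealization h ξ C)
    {i : ι} (hd : 0 < d i) (j : ZMod (d i)) (p : ℤ × S) : HasLabel h ξ C ⟨i, j⟩ p ↔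
      ∃ (I : Set ℤ) (X : ℤ → S), IsStatePath h ξ I X ∧
        p.1 ∈ I ∧ X p.1 = p.2 ∧ ∃ s ∈ I, (d i : ℤ) ∣ s ∧ X s ∈ C i j := by
  constructor
  · intro hp
    obtain ⟨N, hN⟩ := Filter.eventually_atTop.1 hp
    refine ⟨_, _, isStatePath_forward p, Set.mem_Ici.2 le_rfl, by simp, ?_⟩
    have hd1 : (1 : ℤ) ≤ d i := by exact_mod_cast hd
    refine ⟨d i * (|p.1| + N), ?_, dvd_mul_right _ _, ?_⟩
    · have : |p.1| + N ≤ d i * (|p.1| + N) := le_mul_of_one_le_left (by positivity) hd1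
      have := le_abs_self p.1
      exact Set.mem_Ici.2 (by omega)
    · have h1 : |p.1| + N ≤ d i * (|p.1| + N) := le_mul_of_one_le_left (by positivity) hd1
      have h2 := le_abs_self p.1
      have h3 := hN (d i * (|p.1| + N) - p.1).toNat (by omega)
      have h4 : ((followMap h ξ)^[(d i * (|p.1| + N) - p.1).toNat] p).1
          = d i * (|p.1| + N) := by
        rw [fst_iterate_followMap]; omega
      unfold InPhase at h3
      rw [h4] at h3
      simpa using h3
  · rintro ⟨I, X, hX, hpI, hXp, s, hsI, hds, hXs⟩
    have h1 := hX.reachable hpI hsI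
    rw [hXp] at h1
    rw [hasLabel_congr_of_reachable h1]
    refine hreg.hasLabel_of_inPhase ?_
    simpa [InPhase, (ZMod.intCast_zmod_eq_zero_iff_dvd s (d i)).2 hds] using hXs

end Components

/-! ### Components and cyclic classes -/

section Classes

variable {S : Type u} [Countable S] [MeasurableSpace S] [DiscreteMeasurableSpace S]
  {Ξ : Type v} [MeasurableSpace Ξ] {Ω : Type w} [MeasurableSpace Ω]
  {μ : Measure Ω} [IsProbabilityMeasure μ] {h : S × Ξ → S} {ξ : ℤ → Ω → Ξ}
  {ι : Type*} {R : ι → Set S} {d : ι → ℕ} {C : (i : ι) → ZMod (d i) → Set S}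

lemma isClosedClass_of_mem_recurrentClasses (hh : Measurable h) (hξ : ∀ t, Measurable (ξ t))
    (hfull : FullyIndependentTransitions h ξ μ) (hsr : IsStronglyRecurrent h ξ μ) {A : Set S}
    (hA : A ∈ recurrentClasses h ξ μ) : IsClosedClass (transition h ξ μ) A := by
  obtain ⟨x, hx, rfl⟩ := hA
  exact (hsr _ ⟨x, hx, rfl⟩ x (mem_commClass_self x)).isClosedClass hh hξ hfull

lemma isRecurrent_iff_exists_mem (hh : Measurable h) (hξ : ∀ t, Measurable (ξ t))
    (hsr : IsStronglyRecurrent h ξ μ) (hR : Set.range R = recurrentClasses h ξ μ)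
    (hC : ∀ i, IsCyclicDecomposition (transition h ξ μ) (R i) (d i) (C i)) {x : S} :
    IsRecurrent h ξ μ x ↔ ∃ i j, x ∈ C i j := by
  have hiff : ∀ i, x ∈ R i ↔ ∃ j, x ∈ C i j := fun i => by
    rw [← (hC i).iUnion_eq, Set.mem_iUnion]
  simp_rw [← hiff]
  constructor
  · intro hx
    obtain ⟨i, hi⟩ : commClass (transition h ξ μ) x ∈ Set.range R := hR ▸ ⟨x, hx, rfl⟩
    exact ⟨i, hi ▸ mem_commClass_self x⟩
  · rintro ⟨i, hx⟩
    exact (hsr (R i) (hR ▸ Set.mem_range_self i) x hx).isRecurrent hh hξ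

lemma cyclicClass_unique (hinj : Function.Injective R)
    (hR : Set.range R = recurrentClasses h ξ μ)
    (hC : ∀ i, IsCyclicDecomposition (transition h ξ μ) (R i) (d i) (C i))
    (i : ι) (j : ZMod (d i)) (i' : ι) (j' : ZMod (d i')) (hne : (C i j ∩ C i' j').Nonempty) :
    (⟨i, j⟩ : (i : ι) × ZMod (d i)) = ⟨i', j'⟩ := by
  obtain ⟨x, hx, hx'⟩ := hne
  have hclass : ∀ i j, x ∈ C i j → R i = commClass (transition h ξ μ) x := by
    intro i j hx
    have hxR : x ∈ R i := (hC i).iUnion_eq ▸ Set.mem_iUnion_of_mem j hx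
    obtain ⟨y, -, hy⟩ : R i ∈ recurrentClasses h ξ μ := hR ▸ Set.mem_range_self i
    rw [hy] at hxR ⊢
    exact (commClass_eq_of_mem hxR).symm
  obtain rfl := hinj ((hclass i j hx).trans (hclass i' j' hx').symm)
  rw [(hC i).index_eq hx hx']

lemma ae_isRegularRealization (hh : Measurable h) (hξ : ∀ t, Measurable (ξ t))
    (hfull : FullyIndependentTransitions h ξ μ) (hsr : IsStronglyRecurrent h ξ μ)
    (hattr : IsRecurrentAttracting h ξ μ) (hR : Set.range R = recurrentClasses h ξ μ)
    (hd : ∀ i, d i = period (transition h ξ μ) (R i))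
    (hC : ∀ i, IsCyclicDecomposition (transition h ξ μ) (R i) (d i) (C i)) :
    ∀ᵐ ω ∂μ, IsRegularRealization h (fun s => ξ s ω) C := by
  have hP := tsum_transition (μ := μ) hh hξ
  obtain rfl : d = fun i => period (transition h ξ μ) (R i) := funext hd
  have hmemR : ∀ i, R i ∈ recurrentClasses h ξ μ := fun i => hR ▸ Set.mem_range_self i
  have hcl : ∀ i, IsClosedClass (transition h ξ μ) (R i) := fun i =>
    isClosedClass_of_mem_recurrentClasses hh hξ hfull hsr (hmemR i)
  have hsub : ∀ i j, ∀ x ∈ C i j, x ∈ R i := fun i j x hx =>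
    (hC i).iUnion_eq ▸ Set.mem_iUnion_of_mem j hx
  have hhits : ∀ᵐ ω ∂μ, ∀ (t : ℤ) (x : S), ∃ n,
      IsRecurrent h ξ μ (orbit h (fun s => ξ s ω) t x n) :=
    ae_all_iff.2 fun t => ae_all_iff.2 fun x =>
      hattr Ω μ _ (isMarkovChain_orbit hh hξ hfull t x)
  have hmerge : ∀ᵐ ω ∂μ, ∀ (t : ℤ) (x y : S), (∃ i j, x ∈ C i j ∧ y ∈ C i j) →
      ∃ n, orbit h (fun s => ξ s ω) t x n = orbit h (fun s => ξ s ω) t y n := by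
    refine ae_all_iff.2 fun t => ae_all_iff.2 fun x => ae_all_iff.2 fun y => ?_
    by_cases hxy : ∃ i j, x ∈ C i j ∧ y ∈ C i j
    · obtain ⟨i, j, hx, hy⟩ := hxy
      obtain ⟨n, hxx, hxy⟩ := (hC i).exists_common_step hP (hcl i) hx hy
      filter_upwards [ae_exists_orbit_eq hh hξ hfull (hsr _ (hmemR i) x (hsub i j x hx))
        hxx hxy t] with ω hω _ using hω
    · exact ae_of_all _ fun _ hxy' => absurd hxy' hxy
  filter_upwards [ae_transition_pos hh hfull, hhits, hmerge] with ω h1 h2 h3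
  refine ⟨fun i j t x hx => ?_, fun p => ?_, fun i j t x hx y hy => h3 t x y ⟨i, j, hx, hy⟩⟩
  · exact (hC i).step j x hx _ ((hcl i).closed x (hsub i j x hx) _ (h1 t x)) (h1 t x)
  · obtain ⟨n, hn⟩ := h2 p.1 p.2
    exact ⟨n, (isRecurrent_iff_exists_mem hh hξ hsr hR hC).1 hn⟩

theorem components_of_recurrentAttracting (hh : Measurable h) (hξ : ∀ t, Measurable (ξ t))
    (hfull : FullyIndependentTransitions h ξ μ) (hsr : IsStronglyRecurrent h ξ μ)
    (hattr : IsRecurrentAttracting h ξ μ) (hinj : Function.Injective R)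
    (hR : Set.range R = recurrentClasses h ξ μ)
    (hd : ∀ i, d i = period (transition h ξ μ) (R i))
    (hC : ∀ i, IsCyclicDecomposition (transition h ξ μ) (R i) (d i) (C i)) :
    Function.Injective (fun p : (i : ι) × ZMod (d i) => C p.1 p.2) ∧
    ∀ᵐ ω ∂μ, ∃ K : ((i : ι) × ZMod (d i)) ≃
        (graph h fun s => ξ s ω).ConnectedComponent,
      (∀ (i : ι) (j j' : ZMod (d i)) (t : ℤ), ∀ x ∈ C i j,
        ((t, x) ∈ (K ⟨i, j'⟩).supp ↔ j - (t : ZMod (d i)) = j')) ∧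
      (∀ (t : ℤ) (x : S), ¬ IsRecurrent h ξ μ x →
        (∃ n : ℕ, IsRecurrent h ξ μ ((followMap h fun s => ξ s ω)^[n] (t, x)).2) ∧
        ∀ n : ℕ, IsRecurrent h ξ μ ((followMap h fun s => ξ s ω)^[n] (t, x)).2 →
          ∀ p, ((t, x) ∈ (K p).supp ↔
            (followMap h fun s => ξ s ω)^[n] (t, x) ∈ (K p).supp)) ∧
      (∀ (i : ι) (j : ZMod (d i)), (K ⟨i, j⟩).supp =
        {p | ∃ (I : Set ℤ) (X : ℤ → S), IsStatePath h (fun s => ξ s ω) I X ∧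
          p.1 ∈ I ∧ X p.1 = p.2 ∧ ∃ s ∈ I, (d i : ℤ) ∣ s ∧ X s ∈ C i j}) := by
  have hP := tsum_transition (μ := μ) hh hξ
  have hcl : ∀ i, IsClosedClass (transition h ξ μ) (R i) := fun i =>
    isClosedClass_of_mem_recurrentClasses hh hξ hfull hsr (hR ▸ Set.mem_range_self i)
  have hdpos : ∀ i, 0 < d i := fun i => hd i ▸ ((hcl i).period_spec hP).1
  have hne : ∀ i j, (C i j).Nonempty := fun i j => (hC i).nonempty hP (hcl i) (hdpos i) j
  have huniq := cyclicClass_unique hinj hR hC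
  refine ⟨?_, ?_⟩
  · rintro ⟨i, j⟩ ⟨i', j'⟩ heq
    exact huniq i j i' j' (by simp only at heq; rw [← heq, Set.inter_self]; exact hne i j)
  · filter_upwards [ae_isRegularRealization hh hξ hfull hsr hattr hR hd hC] with ω hreg
    obtain ⟨K, hK⟩ := hreg.exists_equiv huniq hne
    refine ⟨K, fun i j j' t x hx => ?_, fun t x _ => ⟨?_, fun n _ p => ?_⟩, fun i j => ?_⟩
    · rw [hK]
      have hlab := hreg.hasLabel_of_mem (p := (t, x)) hx
      constructor
      · intro hl
        simpa using hlab.unique huniq hl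
      · rintro rfl
        exact hlab
    · obtain ⟨n, hn⟩ := hreg.hits (t, x)
      exact ⟨n, (isRecurrent_iff_exists_mem hh hξ hsr hR hC).2 hn⟩
    · rw [hK, hK, hasLabel_iterate_iff]
    · ext p
      rw [hK]
      exact hreg.hasLabel_iff_exists_path (hdpos i) j p

theorem card_components_of_irreducible (hh : Measurable h) (hξ : ∀ t, Measurable (ξ t))
    (hfull : FullyIndependentTransitions h ξ μ) (hirr : IsIrreducible (transition h ξ μ))
    (hpos : ∀ x, IsPositiveRecurrent h ξ μ x) :
    ∀ᵐ ω ∂μ, ENat.card (graph h fun s => ξ s ω).ConnectedComponent =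
      (period (transition h ξ μ) Set.univ : ℕ∞) := by
  have hP := tsum_transition (μ := μ) hh hξ
  obtain ⟨⟨x⟩, hacc⟩ := hirr
  have hcl : IsClosedClass (transition h ξ μ) Set.univ :=
    ⟨⟨x, trivial⟩, fun _ _ _ _ => hacc _ _, fun _ _ _ _ => trivial⟩
  have hrec : ∀ y, IsRecurrent h ξ μ y := fun y => (hpos y).isRecurrent hh hξ
  have hclass : ∀ y, commClass (transition h ξ μ) y = Set.univ := fun y =>
    Set.eq_univ_of_forall fun z => ⟨hacc y z, hacc z y⟩
  have hR : Set.range (fun _ : Unit => (Set.univ : Set S)) = recurrentClasses h ξ μ := by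
    ext A
    constructor
    · rintro ⟨_, rfl⟩
      exact ⟨x, hrec x, (hclass x).symm⟩
    · rintro ⟨y, -, rfl⟩
      exact ⟨(), (hclass y).symm⟩
  have hmain := (components_of_recurrentAttracting hh hξ hfull
    (R := fun _ : Unit => (Set.univ : Set S)) (fun _ _ y _ => hpos y)
    (fun Ω' _ ν _ X _ => ae_of_all _ fun ω => ⟨0, hrec _⟩)
    (Function.injective_of_subsingleton _) hR (fun _ => rfl)
    (fun _ => isCyclicDecomposition_of_irreducible hP hacc x)).2
  have : NeZero (period (transition h ξ μ) Set.univ) := ⟨((hcl.period_spec hP).1).ne'⟩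
  filter_upwards [hmain] with ω hω
  obtain ⟨K, -⟩ := hω
  rw [← ENat.card_congr K, ENat.card_eq_coe_fintype_card]
  simp [ZMod.card]

lemma isEFT_of_card_components
    (hcard : ∀ᵐ ω ∂μ, ENat.card (graph h fun s => ξ s ω).ConnectedComponent = 1) :
    IsEFT h ξ μ := by
  filter_upwards [hcard] with ω hω
  obtain ⟨_⟩ := ENat.card_eq_one_iff_unique.1 hω
  obtain ⟨p, -⟩ := (default : (graph h fun s => ξ s ω).ConnectedComponent).exists_rep
  exact (SimpleGraph.connected_iff _).2 ⟨fun a b =>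
    SimpleGraph.ConnectedComponent.eq.1 (Subsingleton.elim _ _), ⟨p⟩⟩

end Classes

end Doeblin

end

theorem mainTheorem6 {S : Type*} [Countable S] [MeasurableSpace S]
    [DiscreteMeasurableSpace S]
    {Ξ : Type*} [TopologicalSpace Ξ] [PolishSpace Ξ] [MeasurableSpace Ξ] [BorelSpace Ξ]
    {Ω : Type*} [MeasurableSpace Ω] (μ : Measure Ω) [IsProbabilityMeasure μ]
    (h : S × Ξ → S) (hh : Measurable h)
    (ξ : ℤ → Ω → Ξ) (hξ : ∀ t, Measurable (ξ t))
    (hfull : Doeblin.FullyIndependentTransitions h ξ μ) :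
    -- the general statement
    (Doeblin.IsStronglyRecurrent h ξ μ → Doeblin.IsRecurrentAttracting h ξ μ →
      -- `R` lists the recurrent classes without repetition
      ∀ (ι : Type*) (R : ι → Set S), Function.Injective R →
        Set.range R = Doeblin.recurrentClasses h ξ μ →
      ∀ d : ι → ℕ, (∀ i, d i = Doeblin.period (Doeblin.transition h ξ μ) (R i)) →
      ∀ C : (i : ι) → ZMod (d i) → Set S,
        (∀ i, Doeblin.IsCyclicDecomposition (Doeblin.transition h ξ μ) (R i) (d i) (C i)) →
      -- distinct pairs `(i, j)` name distinct cyclic classes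
      Function.Injective (fun p : (i : ι) × ZMod (d i) => C p.1 p.2) ∧
      ∀ᵐ ω ∂μ, ∃ K : ((i : ι) × ZMod (d i)) ≃
          (Doeblin.graph h fun s => ξ s ω).ConnectedComponent,
        -- membership of the vertices with recurrent state
        (∀ (i : ι) (j j' : ZMod (d i)) (t : ℤ), ∀ x ∈ C i j,
          ((t, x) ∈ (K ⟨i, j'⟩).supp ↔ j - (t : ZMod (d i)) = j')) ∧
        -- membership of the vertices with transient state
        (∀ (t : ℤ) (x : S), ¬ Doeblin.IsRecurrent h ξ μ x →
          (∃ n : ℕ, Doeblin.IsRecurrent h ξ μ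
            ((Doeblin.followMap h fun s => ξ s ω)^[n] (t, x)).2) ∧
          ∀ n : ℕ, Doeblin.IsRecurrent h ξ μ
              ((Doeblin.followMap h fun s => ξ s ω)^[n] (t, x)).2 →
            ∀ p, ((t, x) ∈ (K p).supp ↔
              (Doeblin.followMap h fun s => ξ s ω)^[n] (t, x) ∈ (K p).supp)) ∧
        -- each component is the union of the paths through `C i j` at a time divisible by `d i`
        (∀ (i : ι) (j : ZMod (d i)), (K ⟨i, j⟩).supp =
          {p | ∃ (I : Set ℤ) (X : ℤ → S), Doeblin.IsStatePath h (fun s => ξ s ω) I X ∧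
            p.1 ∈ I ∧ X p.1 = p.2 ∧ ∃ s ∈ I, (d i : ℤ) ∣ s ∧ X s ∈ C i j})) ∧
    -- the irreducible positive recurrent case
    (Doeblin.IsIrreducible (Doeblin.transition h ξ μ) →
      (∀ x, Doeblin.IsPositiveRecurrent h ξ μ x) →
      (∀ᵐ ω ∂μ, ENat.card (Doeblin.graph h fun s => ξ s ω).ConnectedComponent =
        (Doeblin.period (Doeblin.transition h ξ μ) Set.univ : ℕ∞)) ∧
      (Doeblin.period (Doeblin.transition h ξ μ) Set.univ = 1 → Doeblin.IsEFT h ξ μ)) := by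
  refine ⟨fun hsr hattr ι R hinj hR d hd C hC =>
    Doeblin.components_of_recurrentAttracting hh hξ hfull hsr hattr hinj hR hd hC,
    fun hirr hpos => ?_⟩
  have hcard := Doeblin.card_components_of_irreducible hh hξ hfull hirr hpos
  refine ⟨hcard, fun hd => Doeblin.isEFT_of_card_components ?_⟩
  simpa [hd] using hcard
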